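/- Let $p$ be a prime and let $G$ be a finite $p$-group. Write $R=\mathbb{Z}_p$. For a finite group $H$, a profinite $RH$-module is a profinite abelian group (possibly not finitely generated) with a continuous $R$-module structure and a continuous $R$-linear action of $H$; for $H=1$ this is a profinite $R$-module. A profinite $RH$-module $M$ is called free if it is free on some profinite space, that is, if there are a profinite space $X$ and a continuous map $\iota:X\to M$ such that for every profinite $RH$-module $W$ and every continuous map $\varphi:X\to W$ there is a unique continuous $RH$-module homomorphism $f:M\to W$ with $f\circ\iota=\varphi$. A profinite $RH$-lattice is a profinite $RH$-module that is free as a profinite $R$-module. Let $U$ be a profinite $\mathbb{Z}_pG$-lattice. Suppose that there is a normal subgroup $N$ of $G$ such that - the restriction $U\!\downarrow_N$ of $U$ to $N$ is a free profinite $\mathbb{Z}_pN$-module, and - the module $U^N$ of $N$-fixed points of $U$, with the subspace topology and the induced action of $G/N$, is a free profinite $\mathbb{Z}_p[G/N]$-module. Then $U$ itself is a free profinite $\mathbb{Z}_pG$-lattice, that is, a profinite $\mathbb{Z}_pG$-lattice that is free as a profinite $\mathbb{Z}_pG$-module. -/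

import Mathlib

universe u

/-- A profinite module over a topological ring `R`: a compact Hausdorff totally disconnected
abelian topological group on which `R` acts continuously. -/
class IsProfiniteModule (R : Type*) (M : Type*) [CommRing R] [TopologicalSpace R]
    [AddCommGroup M] [Module R M] [TopologicalSpace M] : Prop extends
    IsTopologicalAddGroup M, ContinuousSMul R M, CompactSpace M, T2Space M,
    TotallyDisconnectedSpace M

/-- A profinite `R`-module `M` is free if there are a profinite space `X` and a continuous map
`ι : X → M` such that every continuous map from `X` to a profinite `R`-module `W` factors uniquely
through `ι` by a continuous `R`-linear map `M → W`. -/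
def IsFreeProfiniteModule (R : Type*) (M : Type u) [CommRing R] [TopologicalSpace R]
    [AddCommGroup M] [Module R M] [TopologicalSpace M] : Prop :=
  IsProfiniteModule R M ∧
  ∃ (X : Type u) (_ : TopologicalSpace X) (_ : CompactSpace X) (_ : T2Space X)
    (_ : TotallyDisconnectedSpace X) (ι : X → M), Continuous ι ∧
    ∀ (W : Type u) [AddCommGroup W] [Module R W] [TopologicalSpace W] [IsProfiniteModule R W]
      (φ : X → W), Continuous φ → ∃! f : M →L[R] W, ∀ x, f (ι x) = φ x

namespace Representation

/-- A profinite `RG`-module, for a finite group `G`: a profinite `R`-module together with an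
`R`-linear action of `G` by continuous maps. -/
structure IsProfinite {R G M : Type*} [CommRing R] [TopologicalSpace R] [Group G]
    [AddCommGroup M] [Module R M] [TopologicalSpace M] (ρ : Representation R G M) : Prop where
  isProfiniteModule : IsProfiniteModule R M
  continuous_apply : ∀ g : G, Continuous (ρ g)

/-- A profinite `RG`-module is free if there are a profinite space `X` and a continuous map
`ι : X → M` such that every continuous map from `X` to a profinite `RG`-module `W` factors uniquely
through `ι` by a continuous homomorphism of `RG`-modules `M → W`. -/
def IsFreeProfinite {R G : Type*} {M : Type u} [CommRing R] [TopologicalSpace R] [Group G]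
    [AddCommGroup M] [Module R M] [TopologicalSpace M] (ρ : Representation R G M) : Prop :=
  ρ.IsProfinite ∧
  ∃ (X : Type u) (_ : TopologicalSpace X) (_ : CompactSpace X) (_ : T2Space X)
    (_ : TotallyDisconnectedSpace X) (ι : X → M), Continuous ι ∧
    ∀ (W : Type u) [AddCommGroup W] [Module R W] [TopologicalSpace W]
      (σ : Representation R G W), σ.IsProfinite → ∀ φ : X → W, Continuous φ →
      ∃! f : M →L[R] W, (∀ g m, f (ρ g m) = σ g (f m)) ∧ ∀ x, f (ι x) = φ x

/-- A profinite `RG`-lattice: a profinite `RG`-module that is free as a profinite `R`-module. -/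
structure IsProfiniteLattice {R G : Type*} {M : Type u} [CommRing R] [TopologicalSpace R] [Group G]
    [AddCommGroup M] [Module R M] [TopologicalSpace M] (ρ : Representation R G M) : Prop where
  isProfinite : ρ.IsProfinite
  isFreeProfiniteModule : IsFreeProfiniteModule R M

end Representation

/-!
The proof is a form of Higman's criterion and never constructs a free profinite module.

Coinduction (`isBasisMap_of_existsUnique_equivariant`) turns freeness over a finite group `H` on a
space `X` into freeness over the coefficient ring on `H × X`; hence a free module `V` is induced
from a free `R`-module `W` through maps `i : W → V` and `r : V → W` with `r i = 1`,
`r h i = 0` for `h ≠ 1` and `∑ h, h i r h⁻¹ = 1` (`IsBasisMap.exists_induced`). Applied to the restriction of `U` to `N`, this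
gives a continuous `R`-linear `s : U → U` with `∑ n, n s n⁻¹ = 1`, so that `u ↦ ∑ n, n s u` is a
retraction `c` of `U` onto `U^N`. Applied to `U^N` over `G ⧸ N`, it gives `W`, `i` and `r`.

The module `U` is induced from `W` embedded by `s ∘ i`: the map
`F : (G → W) → U`, `w ↦ ∑ g, g s i w_g` is an isomorphism (`bijective_sum_apply`). Indeed
`K : u ↦ (g ↦ r c g⁻¹ u)` is an equivariant map in the other direction, and a computation with
cosets shows that `F` and `K` are inverse to each other on `N`-invariants. This suffices by
`bijective_of_apply_invariant_eq`: let `M` be relatively projective over `N` in the above sense and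
`D` an `N`-endomorphism killing `M^N`. Any vector invariant modulo `p ^ n` is congruent to an
invariant one, so `D` kills it modulo `p ^ n`; as `N` is a `p`-group, fixed points exist in every
nonzero `N`-stable subquotient of `M / p ^ n`, and `D` is pointwise nilpotent there. Thus `1 - D` is
injective and has dense, hence full, image. Finally, a module induced from a free `R`-module is free
(`isFreeProfinite_of_bijective`).
-/

open Topology

universe v w

/-! ### Free modules over a finite group -/

namespace Representation

section Coordinates

variable {R : Type v} {H : Type w} {V : Type u} [CommRing R] [TopologicalSpace R] [Group H]
  [AddCommGroup V] [Module R V] [TopologicalSpace V]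

/-- `IsBasisMap ρ ι` says that the translates of the family `ι : X → V` under the group `H` form a
free system of generators over `R`: continuous maps from `H × X` to a profinite `R`-module extend
uniquely to continuous `R`-linear maps on `V`. The test modules lie in the universe of `V`, as in
`IsFreeProfinite`. -/
def IsBasisMap {X : Type u} [TopologicalSpace X] (ρ : Representation R H V) (ι : X → V) : Prop :=
  ∀ (T : Type u) [AddCommGroup T] [Module R T] [TopologicalSpace T] [IsProfiniteModule R T]
    (φ : H → X → T), (∀ h, Continuous (φ h)) → ∃! f : V →L[R] T, ∀ h x, f (ρ h (ι x)) = φ h x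

theorem isProfiniteModule_pi (R : Type*) {I : Type*} {T : Type*} [CommRing R] [TopologicalSpace R]
    [AddCommGroup T] [Module R T] [TopologicalSpace T] [IsProfiniteModule R T] :
    IsProfiniteModule R (I → T) :=
  have hT := (inferInstance : IsProfiniteModule R T)
  have := hT.toTotallyDisconnectedSpace
  have := hT.toIsTopologicalAddGroup
  have := hT.toContinuousSMul
  have := hT.toCompactSpace
  have := hT.toT2Space
  { }

theorem isProfiniteModule_submodule {R : Type*} {T : Type*} [CommRing R] [TopologicalSpace R]
    [AddCommGroup T] [Module R T] [TopologicalSpace T] [IsProfiniteModule R T]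
    (W : Submodule R T) (hW : IsClosed (W : Set T)) : IsProfiniteModule R W :=
  have hT := (inferInstance : IsProfiniteModule R T)
  have := hT.toTotallyDisconnectedSpace
  have := hT.toIsTopologicalAddGroup
  have := hT.toContinuousSMul
  have := hT.toCompactSpace
  have := hT.toT2Space
  have : CompactSpace W := isCompact_iff_compactSpace.mp hW.isCompact
  { }

/-- The coinduced module `H → T` represents the functor of `R`-linear maps to `T`, so freeness over
`R[H]` on `X` amounts to freeness over `R` on `H × X`. -/
theorem isBasisMap_of_existsUnique_equivariant [Finite H] {ρ : Representation R H V}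
    {X : Type u} [TopologicalSpace X] {ι : X → V} (hρ : ∀ h, Continuous (ρ h))
    (huniv : ∀ (W : Type u) [AddCommGroup W] [Module R W] [TopologicalSpace W]
      (σ : Representation R H W), σ.IsProfinite → ∀ φ : X → W, Continuous φ →
      ∃! f : V →L[R] W, (∀ g m, f (ρ g m) = σ g (f m)) ∧ ∀ x, f (ι x) = φ x) :
    ρ.IsBasisMap ι := by
  intro T _ _ _ _ φ hφ
  -- The index set `Fin n` in place of `H` keeps the coinduced module in the universe of `V`.
  obtain ⟨n, ⟨a⟩⟩ := Finite.exists_equiv_fin H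
  let σ : Representation R H (Fin n → T) :=
    { toFun h := LinearMap.funLeft R T fun k => a (a.symm k * h)
      map_one' := by ext; simp [LinearMap.funLeft]
      map_mul' g h := by ext; simp [LinearMap.funLeft, mul_assoc] }
  have hσ (h : H) (y : Fin n → T) (k : Fin n) : σ h y k = y (a (a.symm k * h)) := rfl
  have hT := isProfiniteModule_pi R (I := Fin n) (T := T)
  have hσp : σ.IsProfinite := ⟨hT, fun h => by
    refine continuous_pi fun k => ?_
    simp only [hσ]
    fun_prop⟩
  obtain ⟨F, ⟨hF, hFι⟩, hFu⟩ := huniv (Fin n → T) σ hσp (fun x k => φ (a.symm k) x) (by fun_prop)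
  refine ⟨(ContinuousLinearMap.proj (a 1)).comp F, fun h x => ?_, fun f hf => ?_⟩
  · simp [hF, hσ, hFι]
  · let F' : V →L[R] (Fin n → T) :=
      ContinuousLinearMap.pi fun k => f.comp ⟨ρ (a.symm k), hρ _⟩
    have hF' (v k) : F' v k = f (ρ (a.symm k) v) := rfl
    have : F' = F := hFu F' ⟨fun g m => by ext k; simp [hF', hσ], fun x => by ext k; simp [hF', hf]⟩
    ext v
    simp [← this, hF']

/-- A free module over `R[H]` is induced from a free `R`-module `W`: with `i : W → V` the inclusion
and `r : V → W` the projection to the coordinate of `1`, the composites `r ∘ h ∘ i` are those of an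
induced module, and every vector is the sum of its components in the translates of `W`. -/
theorem IsBasisMap.exists_induced [Fintype H] [IsProfiniteModule R V] {ρ : Representation R H V}
    {X : Type u} [TopologicalSpace X] {ι : X → V} (hρ : ∀ h, Continuous (ρ h))
    (hι : Continuous ι) (hb : ρ.IsBasisMap ι) :
    ∃ (W : Type u) (_ : AddCommGroup W) (_ : Module R W) (_ : TopologicalSpace W)
      (_ : IsProfiniteModule R W) (i : W →L[R] V) (r : V →L[R] W) (j : X → W),
      (∀ w, r (i w) = w) ∧ (∀ h, h ≠ 1 → ∀ w, r (ρ h (i w)) = 0) ∧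
      (∀ v, ∑ h, ρ h (i (r (ρ h⁻¹ v))) = v) ∧ Continuous j ∧
      ∀ (T : Type u) [AddCommGroup T] [Module R T] [TopologicalSpace T] [IsProfiniteModule R T]
        (φ : X → T), Continuous φ → ∃! f : W →L[R] T, ∀ x, f (j x) = φ x := by
  classical
  have hV := (inferInstance : IsProfiniteModule R V)
  have := hV.toIsTopologicalAddGroup
  have := hV.toT2Space
  have ext {f g : V →L[R] V} (h : ∀ h x, f (ρ h (ι x)) = g (ρ h (ι x))) : f = g :=
    (hb V (fun h x => g (ρ h (ι x))) fun h => g.continuous.comp ((hρ h).comp hι)).unique h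
      fun _ _ => rfl
  obtain ⟨e, he, -⟩ := hb V (fun h x => if h = 1 then ι x else 0) fun h => by
    split_ifs <;> fun_prop
  have he1 (x) : e (ι x) = ι x := by simpa using he 1 x
  let ρc (h : H) : V →L[R] V := ⟨ρ h, hρ h⟩
  have hρc (h v) : ρc h v = ρ h v := rfl
  have hee (v) : e (e v) = e v := by
    refine DFunLike.congr_fun (f := e.comp e) (g := e) (ext fun h x => ?_) v
    by_cases hh : h = 1 <;> simp [he, hh, he1]
  have hee' (k : H) (hk : k ≠ 1) (v) : e (ρ k (e v)) = 0 := by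
    refine DFunLike.congr_fun (f := e.comp ((ρc k).comp e)) (g := 0) (ext fun h x => ?_) v
    by_cases hh : h = 1 <;> simp [he, hh, hρc, hk, he1]
  have hsum (v) : ∑ h, ρ h (e (ρ h⁻¹ v)) = v := by
    have : (∑ h, (ρc h).comp (e.comp (ρc h⁻¹))) = ContinuousLinearMap.id R V := by
      refine ext fun h x => ?_
      simp only [_root_.sum_apply, ContinuousLinearMap.comp_apply, hρc,
        ContinuousLinearMap.id_apply]
      rw [Finset.sum_eq_single h]
      · simp [he1]
      · intro k _ hk
        have : e (ρ k⁻¹ (ρ h (ι x))) = 0 := by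
          rw [← Module.End.mul_apply, ← map_mul, he, if_neg]
          rwa [inv_mul_eq_one]
        rw [this, map_zero]
      · simp
    simpa [hρc] using DFunLike.congr_fun this v
  let W : Submodule R V := LinearMap.eqLocus e.toLinearMap LinearMap.id
  have hW (v) : v ∈ W ↔ e v = v := Iff.rfl
  have hWp : IsProfiniteModule R W :=
    isProfiniteModule_submodule W (isClosed_eq e.continuous continuous_id)
  refine ⟨W, inferInstance, inferInstance, inferInstance, hWp, W.subtypeL,
    e.codRestrict W fun v => hee v, fun x => ⟨ι x, he1 x⟩, fun w => Subtype.ext w.2,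
    fun h hh w => Subtype.ext ?_, fun v => ?_, by fun_prop, ?_⟩
  · have := hee' h hh w
    rw [(hW _).1 w.2] at this
    exact this
  · exact hsum v
  · intro T _ _ _ hT φ hφ
    have hT0 := hT.toIsTopologicalAddGroup
    obtain ⟨f, hf, hfu⟩ := hb T (fun h x => if h = 1 then φ x else 0) fun h => by
      split_ifs <;> fun_prop
    refine ⟨f.comp W.subtypeL, fun x => by simpa using hf 1 x, fun g hg => ?_⟩
    have : g.comp (e.codRestrict W fun v => hee v) = f := hfu _ fun h x => by
      by_cases hh : h = 1
      · subst hh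
        simp only [map_one, Module.End.one_apply, ContinuousLinearMap.comp_apply, if_true, ← hg]
        exact congrArg g (Subtype.ext (he1 x))
      · simp only [ContinuousLinearMap.comp_apply, if_neg hh]
        rw [← map_zero g]
        exact congrArg g (Subtype.ext ((he h x).trans (if_neg hh)))
    ext w
    rw [← this]
    exact congrArg g (Subtype.ext w.2.symm)

end Coordinates

end Representation

/-! ### Endomorphisms of modules over a `p`-group that fix all invariants -/

theorem IsProfiniteModule.exists_pow_smul_mem {p : ℕ} [Fact p.Prime] {M : Type*} [AddCommGroup M]
    [Module ℤ_[p] M] [TopologicalSpace M] [IsProfiniteModule ℤ_[p] M] {O : Set M}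
    (hO : O ∈ 𝓝 (0 : M)) : ∃ n : ℕ, ∀ m : M, (p : ℤ_[p]) ^ n • m ∈ O := by
  have hM := (inferInstance : IsProfiniteModule ℤ_[p] M)
  have := hM.toContinuousSMul
  have := hM.toCompactSpace
  obtain ⟨O', hO'O, hO', h0⟩ := mem_nhds_iff.1 hO
  obtain ⟨u, v, hu, -, h0u, hv, huv⟩ := generalized_tube_lemma (X := ℤ_[p]) (Y := M)
    (s := {0}) isCompact_singleton (t := Set.univ) isCompact_univ
    (hO'.preimage (continuous_smul (M := ℤ_[p]) (X := M))) (by rintro ⟨a, m⟩ ⟨ha, -⟩; simp_all)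
  have ht : Filter.Tendsto (fun n : ℕ => (p : ℤ_[p]) ^ n) Filter.atTop (𝓝 0) :=
    tendsto_pow_atTop_nhds_zero_of_norm_lt_one (by
      rw [PadicInt.norm_p]
      exact inv_lt_one_of_one_lt₀ (mod_cast (Fact.out : p.Prime).one_lt))
  obtain ⟨n, hn⟩ := (ht.eventually (hu.mem_nhds (h0u rfl))).exists
  exact ⟨n, fun m => hO'O (huv (show ((p : ℤ_[p]) ^ n, m) ∈ u ×ˢ v from ⟨hn, hv trivial⟩))⟩

namespace Representation

/-- Every vector generates a finite `p`-group stable under `N`, and a `p`-group acting on a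
nontrivial finite abelian `p`-group has a nonzero fixed point. -/
theorem eq_zero_of_invariants_eq_zero {p : ℕ} [Fact p.Prime] {R N A : Type*} [CommRing R] [Group N]
    [Finite N] (hN : IsPGroup p N) [AddCommGroup A] [Module R A] (ρ : Representation R N A) (n : ℕ)
    (hA : ∀ a : A, p ^ n • a = 0) (h : ∀ a, (∀ g, ρ g a = a) → a = 0) (a : A) : a = 0 := by
  let B : AddSubgroup A := AddSubgroup.closure (Set.range fun g => ρ g a)
  have haB : a ∈ B := AddSubgroup.subset_closure ⟨1, by simp⟩
  have hB (g : N) : B ≤ B.comap (ρ g).toAddMonoidHom := by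
    refine (AddSubgroup.closure_le _).2 ?_
    rintro _ ⟨k, rfl⟩
    exact AddSubgroup.subset_closure ⟨g * k, by simp⟩
  let _ : MulAction N B :=
    { smul g b := ⟨ρ g b, hB g b.2⟩
      one_smul b := Subtype.ext (by change ρ 1 (b : A) = b; simp)
      mul_smul g k b := Subtype.ext (by change ρ (g * k) (b : A) = ρ g (ρ k b); simp) }
  have : AddGroup.FG B := (AddGroup.fg_iff_addSubgroup_fg _).2
    ((AddSubgroup.fg_iff _).2 ⟨_, rfl, Set.finite_range _⟩)
  have : Module.Finite ℤ B := Module.Finite.iff_addGroup_fg.mpr this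
  have hp : p ^ n ≠ 0 := pow_ne_zero _ (Fact.out : p.Prime).ne_zero
  have : Finite B := Module.finite_of_fg_torsion B fun b =>
    ⟨⟨(p ^ n : ℕ), mem_nonZeroDivisors_of_ne_zero (by exact_mod_cast hp)⟩, Subtype.ext <|
      (natCast_zsmul (b : A) (p ^ n)).trans (hA b)⟩
  by_contra ha
  have hdvd : p ∣ Nat.card B := by
    by_contra hd
    have hc : Nat.Coprime (p ^ n) (Nat.card B) :=
      (((Fact.out : p.Prime).coprime_iff_not_dvd).2 hd).pow_left n
    have h1 : addOrderOf (⟨a, haB⟩ : B) = 1 := Nat.eq_one_of_dvd_coprimes hc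
      (addOrderOf_dvd_of_nsmul_eq_zero (Subtype.ext (by simpa using hA a)))
      (addOrderOf_dvd_natCard _)
    exact ha (congrArg Subtype.val (AddMonoid.addOrderOf_eq_one_iff.1 h1))
  obtain ⟨b, hb, hb0⟩ := hN.exists_fixed_point_of_prime_dvd_card_of_fixed_point B hdvd (a := 0)
    fun g => Subtype.ext (map_zero (ρ g))
  exact hb0 (Subtype.ext (h b fun g => congrArg Subtype.val (hb g)).symm)

theorem apply_sum_apply_self {R N M : Type*} [CommRing R] [Group N] [Fintype N] [AddCommGroup M]
    [Module R M] (ρ : Representation R N M) (m : M) (g : N) :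
    ρ g (∑ h, ρ h m) = ∑ h, ρ h m := by
  simpa [norm] using ρ.self_norm_apply g m

/-- Let `e` be an additive map witnessing that `M` is projective relative to the trivial group.
If an equivariant `D` kills all invariants, then `D` is nilpotent at each
vector modulo each power of `p`: the vectors at which it is nilpotent form a submodule, and the
quotient of `M` by it has no nonzero invariants. -/
theorem exists_iterate_eq_pow_smul {p : ℕ} [Fact p.Prime] {N M : Type*} [Group N] [Fintype N]
    (hN : IsPGroup p N) [AddCommGroup M] [Module ℤ_[p] M] (ρ : Representation ℤ_[p] N M)
    (e : M →ₗ[ℤ_[p]] M) (he : ∀ m, ∑ g, ρ g (e (ρ g⁻¹ m)) = m)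
    (D : Module.End ℤ_[p] M) (hD : ∀ g m, D (ρ g m) = ρ g (D m)) 
    (hD0 : ∀ m, (∀ g, ρ g m = m) → D m = 0)
    (n : ℕ) (m : M) : ∃ k : ℕ, ∃ m', (D ^ k) m = (p : ℤ_[p]) ^ n • m' := by
  have hDk (k g m) : (D ^ k) (ρ g m) = ρ g ((D ^ k) m) := by
    induction k generalizing m with
    | zero => rfl
    | succ k ih => rw [pow_succ, Module.End.mul_apply, hD, ih, Module.End.mul_apply]
  have hmono {k l : ℕ} (hkl : k ≤ l) {m : M} (h : ∃ m', (D ^ k) m = (p : ℤ_[p]) ^ n • m') :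
      ∃ m', (D ^ l) m = (p : ℤ_[p]) ^ n • m' := by
    obtain ⟨m', hm'⟩ := h
    exact ⟨(D ^ (l - k)) m', by
      rw [← map_smul, ← hm', ← Module.End.mul_apply, ← pow_add, Nat.sub_add_cancel hkl]⟩
  let S : Submodule ℤ_[p] M :=
    { carrier := {m | ∃ k : ℕ, ∃ m', (D ^ k) m = (p : ℤ_[p]) ^ n • m'}
      zero_mem' := ⟨0, 0, by simp⟩
      add_mem' := by
        rintro a b ⟨k, ha⟩ ⟨l, hb⟩
        obtain ⟨a', ha⟩ := hmono (le_max_left k l) ha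
        obtain ⟨b', hb⟩ := hmono (le_max_right k l) hb
        exact ⟨max k l, a' + b', by rw [map_add, ha, hb, smul_add]⟩
      smul_mem' := by
        rintro c a ⟨k, a', ha⟩
        exact ⟨k, c • a', by rw [map_smul, ha, smul_comm]⟩ }
  have hSinv (g : N) : S ≤ S.comap (ρ g) := by
    rintro a ⟨k, a', ha⟩
    exact ⟨k, ρ g a', by rw [hDk, ha, map_smul]⟩
  have hSfix (m : M) (hm : ∀ g, ρ g m - m ∈ S) : m ∈ S := by
    choose k m' hm' using hm
    -- A common exponent for all group elements.
    have hK (g : N) : ∃ m', (D ^ (∑ g, k g)) (ρ g m - m) = (p : ℤ_[p]) ^ n • m' :=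
      hmono (Finset.single_le_sum (f := k) (fun _ _ => Nat.zero_le _) (Finset.mem_univ g))
        ⟨m' g, hm' g⟩
    choose c hc using hK
    set a := (D ^ (∑ g, k g)) m with ha
    -- `a` is invariant modulo `p ^ n`, hence congruent to the norm of `e a`, which `D` kills.
    have hca (g : N) : ρ g a = a + (p : ℤ_[p]) ^ n • c g := by
      rw [← hc g, map_sub, hDk]; abel
    have hsum : a = ∑ g, ρ g (e a) + (p : ℤ_[p]) ^ n • ∑ g, ρ g (e (c g⁻¹)) := by
      conv_lhs => rw [← he a]
      simp only [hca, map_add, map_smul, Finset.sum_add_distrib, Finset.smul_sum]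
    refine ⟨(∑ g, k g) + 1, D (∑ g, ρ g (e (c g⁻¹))), ?_⟩
    rw [pow_succ', Module.End.mul_apply, ← ha, hsum, map_add, hD0 _ (ρ.apply_sum_apply_self (e a)),
      zero_add, map_smul]
  have hQ := eq_zero_of_invariants_eq_zero hN (ρ.quotient S hSinv) n
    (fun a => by
      induction a using Submodule.Quotient.induction_on with
      | H a =>
        rw [← Submodule.Quotient.mk_smul, Submodule.Quotient.mk_eq_zero]
        exact ⟨0, a, by simp [← Nat.cast_smul_eq_nsmul ℤ_[p]]⟩)
    (fun a => by
      induction a using Submodule.Quotient.induction_on with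
      | H a =>
        intro h
        rw [Submodule.Quotient.mk_eq_zero]
        exact hSfix a fun g => (Submodule.Quotient.eq S).1 (h g))
    (Submodule.Quotient.mk m)
  exact (Submodule.Quotient.mk_eq_zero S).1 hQ

/-- An equivariant endomorphism that is the identity on invariants is bijective: by
`exists_iterate_eq_pow_smul` it differs from the identity by a map that is pointwise nilpotent
modulo each power of `p`. -/
theorem bijective_of_apply_invariant_eq {p : ℕ} [Fact p.Prime] {N M : Type*} [Group N] [Fintype N]
    (hN : IsPGroup p N) [AddCommGroup M] [Module ℤ_[p] M] [TopologicalSpace M]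
    [IsProfiniteModule ℤ_[p] M] (ρ : Representation ℤ_[p] N M)
    (e : M →ₗ[ℤ_[p]] M) (he : ∀ m, ∑ g, ρ g (e (ρ g⁻¹ m)) = m)
    (T : M →L[ℤ_[p]] M) (hT : ∀ g m, T (ρ g m) = ρ g (T m))
    (hT1 : ∀ m, (∀ g, ρ g m = m) → T m = m) : Function.Bijective T := by
  have hM := (inferInstance : IsProfiniteModule ℤ_[p] M)
  have := hM.toIsTopologicalAddGroup
  have := hM.toCompactSpace
  have := hM.toT2Space
  let D : Module.End ℤ_[p] M := 1 - T.toLinearMap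
  have hDT (m) : D m = m - T m := rfl
  have key := exists_iterate_eq_pow_smul hN ρ e he D (fun g m => by simp [hDT, hT])
    (fun m hm => by rw [hDT, hT1 m hm, sub_self])
  constructor
  · rw [injective_iff_map_eq_zero]
    intro m hm
    have hDm (k : ℕ) : (D ^ k) m = m := by
      induction k with
      | zero => rfl
      | succ k ih => rw [pow_succ, Module.End.mul_apply, hDT, hm, sub_zero, ih]
    by_contra hm0
    obtain ⟨n, hn⟩ := IsProfiniteModule.exists_pow_smul_mem (p := p)
      (isOpen_compl_singleton.mem_nhds (show (0 : M) ∈ ({m}ᶜ : Set M) from Ne.symm hm0))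
    obtain ⟨k, m', hk⟩ := key n m
    exact hn m' (by rw [← hk, hDm]; rfl)
  · have hsub (k : ℕ) (m : M) : m - (D ^ k) m ∈ Set.range T := by
      induction k generalizing m with
      | zero => exact ⟨0, by simp⟩
      | succ k ih =>
        obtain ⟨a, ha⟩ := ih (D m)
        refine ⟨m + a, ?_⟩
        rw [map_add, ha, pow_succ, Module.End.mul_apply, hDT]
        abel
    have hdense : DenseRange T := fun m => mem_closure_iff_nhds.2 fun O hO => by
      have hO' : (fun x => m - x) ⁻¹' O ∈ 𝓝 (0 : M) :=
        (continuous_const.sub continuous_id).continuousAt.preimage_mem_nhds (by simpa using hO)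
      obtain ⟨n, hn⟩ := IsProfiniteModule.exists_pow_smul_mem (p := p) hO'
      obtain ⟨k, m', hk⟩ := key n m
      exact ⟨m - (D ^ k) m, by rw [hk]; exact hn m', hsub k m⟩
    exact Set.range_eq_univ.1
      ((isCompact_range T.continuous).isClosed.closure_eq ▸ hdense.closure_range)

end Representation

/-! ### Descent from the normal subgroup and the quotient -/

theorem Subgroup.sum_eq_sum_quotient_out {G A : Type*} [Group G] [AddCommMonoid A] (N : Subgroup G)
    [Fintype G] [Fintype N] [Fintype (G ⧸ N)] (f : G → A) :
    ∑ g, f g = ∑ q : G ⧸ N, ∑ n : N, f (q.out * n) := by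
  rw [← Fintype.sum_prod_type']
  refine (Fintype.sum_bijective (fun x : (G ⧸ N) × N => x.1.out * (x.2 : G)) ⟨?_, fun g => ?_⟩ _ _
    fun _ => rfl).symm
  · rintro ⟨q, n⟩ ⟨q', n'⟩ h
    have hq : q = q' := by
      simpa using congrArg (QuotientGroup.mk (s := N)) h
    subst hq
    simpa using h
  · exact ⟨(QuotientGroup.mk g, ⟨(QuotientGroup.mk (s := N) g).out⁻¹ * g,
      QuotientGroup.eq.1 (QuotientGroup.out_eq' _)⟩), by simp⟩

namespace Representation

/-- The left translation action of `G` on functions `G → W`, a model of the module induced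
from the trivial group. -/
def leftTranslation (R G W : Type*) [CommRing R] [Group G] [AddCommGroup W] [Module R W] :
    Representation R G (G → W) where
  toFun g := LinearMap.funLeft R W fun k => g⁻¹ * k
  map_one' := by ext; simp [LinearMap.funLeft]
  map_mul' g h := by ext; simp [LinearMap.funLeft, mul_assoc]

@[simp] theorem leftTranslation_apply {R G W : Type*} [CommRing R] [Group G] [AddCommGroup W]
    [Module R W] (g : G) (w : G → W) (k : G) : leftTranslation R G W g w k = w (g⁻¹ * k) := rfl

/-- Restriction to a set of coset representatives shows that the induced module is projective
relative to the trivial subgroup of `N`. -/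
theorem exists_sum_leftTranslation_eq (R : Type*) {G : Type*} (W : Type*) [CommRing R] [Group G]
    [AddCommGroup W] [Module R W] (N : Subgroup G) [N.Normal] [Fintype N] :
    ∃ e : (G → W) →ₗ[R] (G → W), ∀ w, ∑ n : N, leftTranslation R G W n
      (e (leftTranslation R G W (n : G)⁻¹ w)) = w := by
  classical
  refine ⟨LinearMap.pi fun g => if (QuotientGroup.mk (s := N) g).out = g then
    LinearMap.proj g else 0, fun w => ?_⟩
  ext g
  have hmk (n : N) : QuotientGroup.mk (s := N) ((n : G)⁻¹ * g) = QuotientGroup.mk g := by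
    rw [QuotientGroup.eq]
    simpa [mul_assoc] using ‹N.Normal›.conj_mem n n.2 g⁻¹
  have hn : g * (QuotientGroup.mk (s := N) g).out⁻¹ ∈ N :=
    ‹N.Normal›.mem_comm (QuotientGroup.eq.1 (QuotientGroup.out_eq' _))
  rw [Finset.sum_apply, Finset.sum_eq_single ⟨_, hn⟩]
  · have := hmk ⟨_, hn⟩
    simp only [leftTranslation_apply, LinearMap.pi_apply, this]
    simp
  · intro n _ hne
    simp only [leftTranslation_apply, LinearMap.pi_apply, hmk]
    rw [if_neg, LinearMap.zero_apply]
    intro h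
    exact hne (Subtype.ext (by simp [h]))
  · simp

section Descent

variable {p : ℕ} [Fact p.Prime] {G U W : Type*} [Group G] [Fintype G]
  [AddCommGroup U] [Module ℤ_[p] U] [TopologicalSpace U] [IsProfiniteModule ℤ_[p] U]
  [AddCommGroup W] [Module ℤ_[p] W] [TopologicalSpace W] [IsProfiniteModule ℤ_[p] W]

/-- If `U` is projective over `N` relative to the trivial group, as witnessed by `s`, and `U^N` is
induced from `W` as a `G ⧸ N`-module, then `U` is induced from `W`, embedded through `s`.
The map `u ↦ (g ↦ r (∑ n, n s (g⁻¹ u)))` inverts the given one on `N`-invariants. -/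
theorem bijective_sum_apply (hG : IsPGroup p G) (ρ : Representation ℤ_[p] G U)
    (hρ : ∀ g, Continuous (ρ g)) (N : Subgroup G) [N.Normal] [Fintype N] [Fintype (G ⧸ N)]
    (s : U →L[ℤ_[p]] U) (hs : ∀ u, ∑ n : N, ρ n (s (ρ (n : G)⁻¹ u)) = u)
    (i : W →L[ℤ_[p]] invariants (ρ.comp N.subtype)) (r : invariants (ρ.comp N.subtype) →L[ℤ_[p]] W)
    (hri : ∀ w, r (i w) = w) (hri' : ∀ q, q ≠ 1 → ∀ w, r (ρ.quotientToInvariants N q (i w)) = 0)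
    (hir : ∀ v, ∑ q, ρ.quotientToInvariants N q (i (r (ρ.quotientToInvariants N q⁻¹ v))) = v)
    (F : (G → W) →L[ℤ_[p]] U) (hF : ∀ w, F w = ∑ g, ρ g (s (i (w g)))) :
    Function.Bijective F := by
  have hU := (inferInstance : IsProfiniteModule ℤ_[p] U)
  have := hU.toIsTopologicalAddGroup
  have hpi : IsProfiniteModule ℤ_[p] (G → W) := isProfiniteModule_pi ℤ_[p]
  set ρ' := ρ.quotientToInvariants N with hρ'
  have hρ'mk (g : G) (v) : (ρ' (QuotientGroup.mk g) v : U) = ρ g v := rfl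
  have hinv (v : invariants (ρ.comp N.subtype)) {n : G} (hn : n ∈ N) : ρ n (v : U) = v :=
    v.2 ⟨n, hn⟩
  -- The retraction of `U` onto `U^N` given by `s`.
  let c : U →L[ℤ_[p]] invariants (ρ.comp N.subtype) :=
    (∑ n : N, (⟨ρ n, hρ n⟩ : U →L[ℤ_[p]] U).comp s).codRestrict _ fun u => by
      intro n
      simpa using apply_sum_apply_self (ρ.comp N.subtype) (s u) n
  have hc (u) : (c u : U) = ∑ n : N, ρ n (s u) := by
    change (∑ n : N, (⟨ρ n, hρ n⟩ : U →L[ℤ_[p]] U).comp s) u = _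
    simp
  have hcv (v : invariants (ρ.comp N.subtype)) : c v = v := by
    apply Subtype.ext
    rw [hc]
    conv_rhs => rw [← hs v]
    exact Finset.sum_congr rfl fun n _ => by rw [hinv v (inv_mem n.2)]
  let K : U →L[ℤ_[p]] (G → W) :=
    ContinuousLinearMap.pi fun g => r.comp (c.comp ⟨ρ g⁻¹, hρ _⟩)
  have hK (u g) : K u g = r (c (ρ g⁻¹ u)) := rfl
  have hKv (v : invariants (ρ.comp N.subtype)) (g : G) :
      K v g = r (ρ' (QuotientGroup.mk g)⁻¹ v) := by
    rw [hK, ← QuotientGroup.mk_inv, ← hρ'mk, hcv]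
  have hFK (g : G) (w) : F (leftTranslation ℤ_[p] G W g w) = ρ g (F w) := by
    rw [hF, hF, map_sum]
    exact (Fintype.sum_equiv (Equiv.mulLeft g) _ _ fun h => by simp).symm
  have hKF (g : G) (u) : K (ρ g u) = leftTranslation ℤ_[p] G W g (K u) := by
    ext k
    simp [hK]
  have hFinv (w : G → W) (hw : ∀ g, ∀ n ∈ N, w (g * n) = w g) :
      F w = (∑ q, ρ' q (i (w q.out)) : invariants (ρ.comp N.subtype)) := by
    rw [hF, N.sum_eq_sum_quotient_out, AddSubmonoidClass.coe_finsetSum]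
    refine Finset.sum_congr rfl fun q _ => ?_
    conv_rhs => rw [← QuotientGroup.out_eq' q, hρ'mk, QuotientGroup.out_eq', ← hcv (i _), hc,
      map_sum]
    exact Finset.sum_congr rfl fun n _ => by rw [hw _ _ n.2, map_mul, Module.End.mul_apply]
  have hFK1 (v : invariants (ρ.comp N.subtype)) : F (K v) = v := by
    rw [hFinv]
    · conv_rhs => rw [← hir v]
      congr 1
      refine Finset.sum_congr rfl fun q _ => ?_
      rw [hKv, QuotientGroup.out_eq']
    · intro g n hn
      rw [hKv, hKv, QuotientGroup.mk_mul_of_mem g hn]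
  have hKF1 (w : G → W) (hw : ∀ g, ∀ n ∈ N, w (g * n) = w g) : K (F w) = w := by
    ext h
    rw [hFinv w hw, hKv, map_sum, map_sum, Finset.sum_eq_single (QuotientGroup.mk h)]
    · rw [← Module.End.mul_apply, ← map_mul, inv_mul_cancel, map_one, Module.End.one_apply, hri]
      conv_rhs => rw [← hw h (h⁻¹ * (QuotientGroup.mk (s := N) h).out)
        (QuotientGroup.eq.1 (QuotientGroup.out_eq' _).symm), mul_inv_cancel_left]
    · intro q _ hq
      rw [← Module.End.mul_apply, ← map_mul, hri']
      rwa [Ne, inv_mul_eq_one, eq_comm]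
    · simp
  have hN : IsPGroup p N := hG.to_subgroup N
  have hFKbij : Function.Bijective (F.comp K) :=
    bijective_of_apply_invariant_eq hN (ρ.comp N.subtype) s hs (F.comp K)
      (fun n u => by simp [hKF, hFK]) fun u hu => hFK1 ⟨u, hu⟩
  obtain ⟨e, he⟩ := exists_sum_leftTranslation_eq ℤ_[p] W N
  have hKFbij : Function.Bijective (K.comp F) := by
    refine bijective_of_apply_invariant_eq hN ((leftTranslation ℤ_[p] G W).comp N.subtype) e he
      (K.comp F) (fun n w => by simp [hKF, hFK]) fun w hw => hKF1 w fun g n hn => ?_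
    have := congrFun (hw ⟨g * n⁻¹ * g⁻¹, ‹N.Normal›.conj_mem _ (inv_mem hn) g⟩) g
    simpa [mul_assoc] using this
  exact ⟨.of_comp (f := K) hKFbij.1, .of_comp (g := K) hFKbij.2⟩

end Descent

/-- A module induced from a free profinite `R`-module is free on the same space. -/
theorem isFreeProfinite_of_bijective {R : Type*} {G : Type*} {U W X : Type u} [CommRing R]
    [TopologicalSpace R] [Group G] [Fintype G]
    [AddCommGroup U] [Module R U] [TopologicalSpace U]
    [AddCommGroup W] [Module R W] [TopologicalSpace W] [IsProfiniteModule R W]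
    [TopologicalSpace X] [CompactSpace X] [T2Space X] [TotallyDisconnectedSpace X]
    (ρ : Representation R G U) (hρ : ρ.IsProfinite) (k : W →L[R] U) (j : X → W) (hj : Continuous j)
    (hfree : ∀ (T : Type u) [AddCommGroup T] [Module R T] [TopologicalSpace T]
      [IsProfiniteModule R T] (φ : X → T), Continuous φ → ∃! f : W →L[R] T, ∀ x, f (j x) = φ x)
    (F : (G → W) →L[R] U) (hF : ∀ w, F w = ∑ g, ρ g (k (w g))) (hFb : Function.Bijective F) :
    ρ.IsFreeProfinite := by
  classical
  have hU := hρ.isProfiniteModule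
  have := hU.toT2Space
  have hpi : IsProfiniteModule R (G → W) := isProfiniteModule_pi R
  have := hpi.toCompactSpace
  let E : (G → W) ≃ₗ[R] U := LinearEquiv.ofBijective F.toLinearMap hFb
  have hE (w) : E w = F w := rfl
  -- A continuous bijection of compact Hausdorff spaces is a homeomorphism.
  have hEs : Continuous E.symm :=
    (Continuous.homeoOfEquivCompactToT2 (f := E.toEquiv) F.continuous).symm.continuous
  have hE1 (w : W) : E (Pi.single 1 w) = k w := by
    rw [hE, hF, Finset.sum_eq_single 1]
    · simp
    · intro g _ hg
      simp [hg]
    · simp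
  have hEg (g : G) (u) : E.symm (ρ g u) = leftTranslation R G W g (E.symm u) := by
    rw [LinearEquiv.symm_apply_eq, hE, hF]
    conv_lhs => rw [← E.apply_symm_apply u, hE, hF, map_sum]
    exact Fintype.sum_equiv (Equiv.mulLeft g) _ _ fun h => by simp
  refine ⟨hρ, X, inferInstance, inferInstance, inferInstance, inferInstance, fun x => k (j x),
    by fun_prop, ?_⟩
  intro T _ _ _ σ hσ φ hφ
  have hT := hσ.isProfiniteModule
  have := hT.toIsTopologicalAddGroup
  obtain ⟨f, hf, hfu⟩ := hfree T φ hφ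
  let f' : U →L[R] T :=
    (∑ g, (⟨σ g, hσ.continuous_apply g⟩ : T →L[R] T).comp
      (f.comp (ContinuousLinearMap.proj g))).comp ⟨E.symm.toLinearMap, hEs⟩
  have hf' (u) : f' u = ∑ g, σ g (f (E.symm u g)) := by
    simp [f']
  refine ⟨f', ⟨fun g u => ?_, fun x => ?_⟩, fun f₂ ⟨h₁, h₂⟩ => ?_⟩
  · rw [hf', hf', hEg, map_sum]
    exact (Fintype.sum_equiv (Equiv.mulLeft g) _ _ fun h => by simp).symm
  · dsimp only
    rw [hf', ← hE1, E.symm_apply_apply, Finset.sum_eq_single 1]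
    · simp [hf]
    · intro g _ hg
      simp [hg]
    · simp
  · have : f₂.comp k = f := hfu _ h₂
    ext u
    rw [hf']
    conv_lhs => rw [← E.apply_symm_apply u, hE, hF, map_sum]
    simp [h₁, ← this]

end Representation

theorem theorem1p2 {p : ℕ} [Fact p.Prime] {G : Type*} [Group G] [Finite G] (hG : IsPGroup p G)
    {U : Type*} [AddCommGroup U] [Module ℤ_[p] U] [TopologicalSpace U]
    (ρ : Representation ℤ_[p] G U) (hU : ρ.IsProfiniteLattice)
    (N : Subgroup G) [N.Normal]
    (hres : Representation.IsFreeProfinite (ρ.comp N.subtype))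
    (hinv : Representation.IsFreeProfinite (ρ.quotientToInvariants N)) :
    ρ.IsProfiniteLattice ∧ ρ.IsFreeProfinite := by
  refine ⟨hU, ?_⟩
  have hUp := hU.isProfinite.isProfiniteModule
  have := hUp.toIsTopologicalAddGroup
  have hρ := hU.isProfinite.continuous_apply
  have := Fintype.ofFinite G
  have := Fintype.ofFinite N
  have := Fintype.ofFinite (G ⧸ N)
  obtain ⟨_, Y, _, _, _, _, κ, hκ, hκu⟩ := hres
  obtain ⟨W', _, _, _, _, i', r', -, -, -, hir', -⟩ :=
    (Representation.isBasisMap_of_existsUnique_equivariant (ρ := ρ.comp N.subtype)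
      (fun n => hρ n) hκu).exists_induced (ρ := ρ.comp N.subtype) (fun n => hρ n) hκ
  obtain ⟨hV, X, _, _, _, _, ι, hι, hιu⟩ := hinv
  have := hV.isProfiniteModule
  obtain ⟨W, _, _, _, hW, i, r, j, hri, hri', hir, hj, hfree⟩ :=
    (Representation.isBasisMap_of_existsUnique_equivariant hV.continuous_apply hιu).exists_induced
      hV.continuous_apply hι
  let k : W →L[ℤ_[p]] U := (i'.comp r').comp ((Submodule.subtypeL _).comp i)
  let F : (G → W) →L[ℤ_[p]] U :=
    ∑ g, (⟨ρ g, hρ g⟩ : U →L[ℤ_[p]] U).comp (k.comp (ContinuousLinearMap.proj g))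
  have hF (w) : F w = ∑ g, ρ g (k (w g)) := by simp [F]
  exact Representation.isFreeProfinite_of_bijective ρ hU.isProfinite k j hj hfree F hF
    (Representation.bijective_sum_apply hG ρ hρ N (i'.comp r') (fun u => by simpa using hir' u)
      i r hri hri' hir F hF)
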